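/- **Theorem 4.3.** Setting. Balls are allocated into $n$ bins in rounds $t=0,1,2,\dots$. The load vector after $t$ rounds is $x^t\in\mathbb{Z}_{\ge0}^n$, with $x^0=0$. Let $W^t=\sum_j x_j^t$, let $y_j^t=x_j^t-W^t/n$ be the normalized load of bin $j$, and let $\mathrm{Gap}(t)=\max_j x_j^t-W^t/n$. Let $(\mathfrak F^t)_{t\ge 0}$ be a filtration such that $\mathfrak F^t$ reveals $x^t$ (it may also contain further information about the past). In round $t$ a random bin $i^t$ is sampled, and then balls are placed. A *filling process* is such a process that satisfies the following two conditions in every round $t$, almost surely. * $\mathcal P_1$: For some labeling of the bins with $y_1^t\ge y_2^t\ge\dots\ge y_n^t$, the conditional distribution $p_a^t=\Pr[i^t=a\mid\mathfrak F^t]$ is majorized by the uniform distribution, i.e. $\sum_{a=1}^k p^t_a\le k/n$ for all $1\le k\le n$. * $\mathcal W_1$: Let $i=i^t$. If $y_i^t\ge 0$, then a single ball is placed, into bin $i$. If $y_i^t<0$, then exactly $\lceil -y_i^t\rceil+1$ balls are placed (not necessarily into bin $i$), in such a way that for some bins $k_1,k_2$, bin $k_1$ receives at most $\max\{0,\lceil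 -y_{k_1}^t\rceil+1\}$ balls, bin $k_2$ (if $k_2\neq k_1$) receives at most $\max\{0,\lceil -y_{k_2}^t\rceil\}$ balls, and every other bin $j$ receives at most $\max\{0,\lceil -y_j^t\rceil-1\}$ balls. Both the distribution $p^t$ and the placement of the balls may depend on the past. Claim. There is a constant $C>0$ such that for every $n\ge1$, every filling process with $n$ bins and every $m\ge1$, $$\Pr\left[\mathrm{Gap}(m)\le C\log n\right]\ge 1-n^{-2}.$$ Moreover, the following two processes are filling processes. Both sample $i=i^t$ uniformly, independently of $\mathfrak F^t$, and place one ball into $i$ if $y_i^t\ge0$. If $y_i^t<0$, they act as follows. * Packing: bin $i$ is filled up to $x_i^{t+1}=\lceil W^t/n\rceil+1$. * OverPacking: $\lceil -y_i^t\rceil+1$ balls are placed greedily into the underloaded bins (those with $y_k^t<0$), taken in some order of non-increasing load. The first such bin $j$ receives $\lceil -y_j^t\rceil$ balls. Then the following ones are successively given up to $\lceil -y_k^t\rceil-1$ balls each, i.e. as many as possible below load $W^t/n$. If one ball is left when all of them are full, it goes to $j$ too. -/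

import Mathlib

open scoped MeasureTheory ProbabilityTheory

namespace BallsBins

noncomputable section

/-- The total number of balls `W` in the load vector `x`. -/
def total {n : ℕ} (x : Fin n → ℕ) : ℕ := ∑ j, x j

/-- The average load `W / n`. -/
def avg {n : ℕ} (x : Fin n → ℕ) : ℝ := (total x : ℝ) / n

/-- The normalized load `y_j = x_j - W / n` of bin `j`. -/
def normLoad {n : ℕ} (x : Fin n → ℕ) (j : Fin n) : ℝ := (x j : ℝ) - avg x

/-- The gap `max_j x_j - W / n`. -/
def gap {n : ℕ} (x : Fin n → ℕ) : ℝ := (⨆ j, (x j : ℝ)) - avg x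

/-- `p` majorizes `q`: every prefix sum of `p` is at least the one of `q`
(in the given order of the coordinates). -/
def Majorizes {n : ℕ} (p q : Fin n → ℝ) : Prop :=
  ∀ k : ℕ, 1 ≤ k → k ≤ n →
    ∑ j with j.val < k, q j ≤ ∑ j with j.val < k, p j

/-- The uniform distribution vector. -/
def uniformVec (n : ℕ) : Fin n → ℝ := fun _ => 1 / n

/-- `σ` lists the bins in the order of non-increasing load: `σ a` is the bin with label `a`. -/
def IsSortedLabeling {n : ℕ} (x : Fin n → ℕ) (σ : Equiv.Perm (Fin n)) : Prop :=
  Antitone fun a => x (σ a)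

section Conditions

variable {n : ℕ} {Ω : Type*} [mΩ : MeasurableSpace Ω]

/-- A (random, possibly adaptive) allocation process with `n` bins on a probability space with
a filtration `ℱ`: `x t` is the load vector after `t` rounds and `i t` is the bin
sampled in round `t`. The load vector is initially zero, and `ℱ t` reveals `x t`; it may
contain any further information about the past. -/
structure IsAllocationProcess (μ : MeasureTheory.Measure Ω) (ℱ : MeasureTheory.Filtration ℕ mΩ)
    (x : ℕ → Ω → Fin n → ℕ) (i : ℕ → Ω → Fin n) : Prop where
  measurable_load : ∀ t, Measurable[ℱ t] (x t)
  measurable_bin : ∀ t, Measurable (i t)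
  load_zero : ∀ᵐ ω ∂μ, x 0 ω = 0

/-- The conditional probability, given `ℱ t`, that bin `k` is sampled in round `t`. -/
def selProb (μ : MeasureTheory.Measure Ω) (ℱ : MeasureTheory.Filtration ℕ mΩ)
    (i : ℕ → Ω → Fin n) (t : ℕ) (k : Fin n) : Ω → ℝ :=
  μ⟦{ω | i t ω = k} | ℱ t⟧

/-- Condition `P₁` in every round: for some labeling of the bins by non-increasing load, the
distribution vector of the sampled bin given `ℱ t` is majorized by the uniform one. -/
def ConditionP1 (μ : MeasureTheory.Measure Ω) (ℱ : MeasureTheory.Filtration ℕ mΩ)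
    (x : ℕ → Ω → Fin n → ℕ) (i : ℕ → Ω → Fin n) : Prop :=
  ∀ t, ∀ᵐ ω ∂μ, ∃ σ : Equiv.Perm (Fin n), IsSortedLabeling (x t ω) σ ∧
    Majorizes (uniformVec n) (fun a => selProb μ ℱ i t (σ a) ω)

/-- One round of condition `W₁`: bin `i` was sampled at the load vector `x`, and `x'` is the next
load vector; `b j` is the number of balls that bin `j` receives. The truncation
`Int.toNat` says that a bin whose bound is negative receives no ball. -/
def FillingStep (x : Fin n → ℕ) (i : Fin n) (x' : Fin n → ℕ) : Prop :=
  ∃ b : Fin n → ℕ, (∀ j, x' j = x j + b j) ∧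
    (normLoad x i < 0 →
      ((∑ j, b j : ℕ) : ℤ) = ⌈-normLoad x i⌉ + 1 ∧
      ∃ k₁ k₂ : Fin n,
        b k₁ ≤ (⌈-normLoad x k₁⌉ + 1).toNat ∧
        (k₂ ≠ k₁ → b k₂ ≤ ⌈-normLoad x k₂⌉.toNat) ∧
        ∀ j, j ≠ k₁ → j ≠ k₂ → b j ≤ (⌈-normLoad x j⌉ - 1).toNat) ∧
    (0 ≤ normLoad x i → b = Pi.single i 1)

/-- Condition `W₁` in every round. -/
def ConditionW1 (μ : MeasureTheory.Measure Ω)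
    (x : ℕ → Ω → Fin n → ℕ) (i : ℕ → Ω → Fin n) : Prop :=
  ∀ t, ∀ᵐ ω ∂μ, FillingStep (x t ω) (i t ω) (x (t + 1) ω)

/-- In every round, the sampled bin is uniform given the past. -/
def UniformSampling (μ : MeasureTheory.Measure Ω) (ℱ : MeasureTheory.Filtration ℕ mΩ)
    (i : ℕ → Ω → Fin n) : Prop :=
  ∀ t k, ∀ᵐ ω ∂μ, selProb μ ℱ i t k ω = 1 / n

/-- One round of Packing: an underloaded sampled bin is filled up to `⌈W / n⌉ + 1` balls,
any other sampled bin receives one ball. -/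
def PackingStep (x : Fin n → ℕ) (i : Fin n) (x' : Fin n → ℕ) : Prop :=
  (∀ j, j ≠ i → x' j = x j) ∧
  (normLoad x i < 0 → (x' i : ℤ) = ⌈avg x⌉ + 1) ∧
  (0 ≤ normLoad x i → x' i = x i + 1)

/-- One round of OverPacking. If the sampled bin `i` is underloaded, then `⌈-y_i⌉ + 1` balls are
placed greedily into the underloaded bins of highest load. The first of them, `j`, is raised
to a load in `[W / n, W / n + 1)`, and the next ones are successively raised as far as possible
below `W / n`. If this leaves a ball (all underloaded bins are then full), that ball goes
to `j` too. -/
def OverPackingStep (x : Fin n → ℕ) (i : Fin n) (x' : Fin n → ℕ) : Prop :=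
  ∃ b : Fin n → ℕ, (∀ k, x' k = x k + b k) ∧
    (normLoad x i < 0 →
      ((∑ k, b k : ℕ) : ℤ) = ⌈-normLoad x i⌉ + 1 ∧
      ∃ (σ : Equiv.Perm (Fin n)) (j : Fin n), IsSortedLabeling x σ ∧
        normLoad x j < 0 ∧
        (∀ k, normLoad x k < 0 → σ.symm j ≤ σ.symm k) ∧
        (∀ k, k ≠ j → b k ≤ (⌈-normLoad x k⌉ - 1).toNat) ∧
        (∀ k l, k ≠ j → normLoad x k < 0 → σ.symm k < σ.symm l → 0 < b l →
          b k = (⌈-normLoad x k⌉ - 1).toNat) ∧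
        ((b j : ℤ) = ⌈-normLoad x j⌉ ∨
          ((b j : ℤ) = ⌈-normLoad x j⌉ + 1 ∧
            ∀ k, k ≠ j → b k = (⌈-normLoad x k⌉ - 1).toNat))) ∧
    (0 ≤ normLoad x i → b = Pi.single i 1)

end Conditions

end

end BallsBins

/-!
The gap is controlled by the exponential potential `Σ exp (y_j / 32)` over the overloaded bins
(`weight`). A round lets such a bin grow only if it is the sampled one, which by majorization
costs at most a factor `1 + (exp (1 / 32) - 1) / n` on average, and makes at most two bins newly
overloaded, with normalized load below `2`. On the other hand the average load rises by `G / n`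
if `G` balls are placed, and every weight shrinks accordingly. So the potential contracts whenever
the mean of `G` exceeds `1` by a constant.

All numbers `n * y_j` are congruent to `-W` modulo `n`. If the residue `r` of `-W` is at least about
`n / 2`, then an overloaded bin has `y_j ≥ r / n ≥ 1 / 3`; as overload and underload are equal,
and an underloaded bin calls for `⌈-y_j⌉ + 1 ≥ 2` balls, the mean of `G` is at least `5 / 4`
(`sum_min_balls_ge`). For smaller residues the mean of `G` may be `1`, as in the perfectly balanced
configuration, and the potential may grow by a factor `1 + O(1 / 32 ^ 2) / n`. But the residue
drops with every ball, so this phase is left by itself. The factor `exp (tent n W)`, a bounded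
function of `W` modulo `n`, settles the account between the two phases: it decreases with every
ball in the second phase and its increase in the first one, at a rate of order `1 / 32 ^ 2` per
`n` balls, is small compared with the contraction there. The corrected potential `pot` therefore
satisfies a one-step drift inequality `E[pot'] ≤ (1 - c / n) pot + 6` in every configuration
(`pot_le_stepBound`, `sum_mul_stepBound_le`), so that its mean is `O(n)` at all times
(`integral_pot_le`), and Markov's inequality gives the bound on the gap.

For Packing and OverPacking, all balls beyond the bounds for ordinary bins go to a single bin,
which takes the role of both exceptional bins.
-/

open scoped MeasureTheory ProbabilityTheory

namespace BallsBins

/-! ### The residue of the total load and the tent function -/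

/-- The residue of `-W` modulo `n`: all numbers `n * y_j` are congruent to it. -/
def residue (n W : ℕ) : ℤ := (-(W : ℤ)) % n

/-- A function with values in `[0, 1 / 512]` of the residue `r` of `-W`, rising in `r` up to about
`n / 2` and falling afterwards, with slope `1 / (512 n)`. Since `r` goes down by one with each
ball, `tent` falls with each ball while `r` is small. The offsets `r + 1` and `n - 1 - r` make this
true also for the step from `r = 0` to `r = n - 1`. -/
noncomputable def tent (n W : ℕ) : ℝ :=
  (min (residue n W + 1) (n - 1 - residue n W) : ℤ) / (512 * n)

lemma residue_nonneg {n : ℕ} (hn : 2 ≤ n) (W : ℕ) : 0 ≤ residue n W :=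
  Int.emod_nonneg _ (by omega)

lemma residue_lt {n : ℕ} (hn : 2 ≤ n) (W : ℕ) : residue n W < n :=
  Int.emod_lt_of_pos _ (by omega)

lemma residue_succ {n : ℕ} (hn : 2 ≤ n) (W : ℕ) :
    (1 ≤ residue n W ∧ residue n (W + 1) = residue n W - 1) ∨
      (residue n W = 0 ∧ residue n (W + 1) = n - 1) := by
  have h0 := residue_nonneg hn W
  have h1 := residue_lt hn W
  have h2 : residue n (W + 1) = (residue n W - 1) % n := by
    unfold residue
    rw [Int.emod_sub_emod]
    congr 1
    push_cast
    ring
  rcases h0.eq_or_lt with h | h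
  · right
    refine ⟨h.symm, ?_⟩
    rw [h2, ← h, ← Int.add_emod_right]
    rw [Int.emod_eq_of_lt] <;> omega
  · left
    refine ⟨h, ?_⟩
    rw [h2, Int.emod_eq_of_lt] <;> omega

lemma tent_nonneg {n : ℕ} (hn : 2 ≤ n) (W : ℕ) : 0 ≤ tent n W := by
  have h0 := residue_nonneg hn W
  have h1 := residue_lt hn W
  have : (0 : ℤ) ≤ min (residue n W + 1) (n - 1 - residue n W) := by omega
  unfold tent
  have : (0 : ℝ) ≤ (min (residue n W + 1) (n - 1 - residue n W) : ℤ) := by exact_mod_cast this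
  positivity

lemma tent_le {n : ℕ} (hn : 2 ≤ n) (W : ℕ) : tent n W ≤ 1 / 512 := by
  have h0 := residue_nonneg hn W
  have : min (residue n W + 1) (n - 1 - residue n W) ≤ (n : ℤ) := by omega
  have : ((min (residue n W + 1) (n - 1 - residue n W) : ℤ) : ℝ) ≤ n := by exact_mod_cast this
  have hn' : (0 : ℝ) < n := by positivity
  unfold tent
  rw [div_le_div_iff₀ (by positivity) (by norm_num)]
  linarith

lemma tent_succ_le {n : ℕ} (hn : 2 ≤ n) (W : ℕ) :
    tent n (W + 1) ≤ tent n W + 1 / (512 * n) := by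
  have h1 := residue_lt hn W
  have h2 := residue_succ hn W
  have : min (residue n (W + 1) + 1) (n - 1 - residue n (W + 1)) ≤
      min (residue n W + 1) (n - 1 - residue n W) + 1 := by omega
  unfold tent
  rw [← add_div]
  gcongr
  exact_mod_cast this

lemma tent_succ_le_of_residue_small {n : ℕ} (hn : 2 ≤ n) {W : ℕ}
    (h : 2 * residue n W + 2 ≤ n) :
    tent n (W + 1) ≤ tent n W - 1 / (512 * n) := by
  have h2 := residue_succ hn W
  have : min (residue n (W + 1) + 1) (n - 1 - residue n (W + 1)) ≤
      min (residue n W + 1) (n - 1 - residue n W) - 1 := by omega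
  unfold tent
  rw [← sub_div]
  gcongr
  exact_mod_cast this

lemma tent_add_le {n : ℕ} (hn : 2 ≤ n) (W g : ℕ) :
    tent n (W + g) ≤ tent n W + g / (512 * n) := by
  induction g with
  | zero => simp
  | succ g ih =>
    have := tent_succ_le hn (W + g)
    rw [← add_assoc]
    push_cast
    rw [add_div]
    linarith

/-! ### The number of balls placed in a round -/

/-- The number of balls placed in a round in which bin `j` is sampled. -/
noncomputable def balls {n : ℕ} (x : Fin n → ℕ) (j : Fin n) : ℕ :=
  if 0 ≤ normLoad x j then 1 else (⌈-normLoad x j⌉ + 1).toNat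

lemma natCast_mul_normLoad {n : ℕ} (hn : 2 ≤ n) (x : Fin n → ℕ) (j : Fin n) :
    (n : ℝ) * normLoad x j = (((n : ℤ) * x j - total x : ℤ) : ℝ) := by
  have : (n : ℝ) ≠ 0 := by positivity
  unfold normLoad avg
  push_cast
  field_simp

lemma one_le_balls {n : ℕ} (x : Fin n → ℕ) (j : Fin n) : 1 ≤ balls x j := by
  unfold balls
  split_ifs with h
  · rfl
  · have : 0 < ⌈-normLoad x j⌉ := Int.ceil_pos.2 (by linarith)
    omega

lemma balls_anti {n : ℕ} (x : Fin n → ℕ) {j k : Fin n} (h : x j ≤ x k) :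
    balls x k ≤ balls x j := by
  have h' : normLoad x j ≤ normLoad x k := by
    unfold normLoad
    have : (x j : ℝ) ≤ x k := by exact_mod_cast h
    linarith
  by_cases hk : 0 ≤ normLoad x k
  · have := one_le_balls x j
    simpa [balls, hk] using this
  · have hj : ¬ 0 ≤ normLoad x j := by linarith
    have : ⌈-normLoad x k⌉ ≤ ⌈-normLoad x j⌉ := Int.ceil_mono (by linarith)
    simp only [balls, hk, hj, if_false]
    omega

/-- The number `n * y_j` of an overloaded bin is congruent to `-W`, so it is at least the residue. -/
lemma residue_le_of_nonneg {n : ℕ} (hn : 2 ≤ n) (x : Fin n → ℕ) (j : Fin n)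
    (h : (total x : ℤ) ≤ n * x j) : residue n (total x) ≤ n * x j - total x := by
  have : residue n (total x) = ((n : ℤ) * x j - total x) % n := by
    unfold residue
    rw [sub_eq_neg_add, Int.add_mul_emod_self_left]
  rw [this]
  have h1 := Int.emod_add_mul_ediv ((n : ℤ) * x j - total x) n
  have h2 : 0 ≤ ((n : ℤ) * x j - total x) / n := Int.ediv_nonneg (by linarith) (by positivity)
  have h3 : 0 ≤ (n : ℤ) * (((n : ℤ) * x j - total x) / n) := by positivity
  linarith

/-- Unless the residue is small, the number of placed balls, even capped at `n + 1`, has mean at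
least `5 / 4` for a uniformly sampled bin: an overloaded bin has `y_j ≥ 1 / 3`, the overload
equals the underload, and the latter is what the underloaded bins contribute. -/
lemma sum_min_balls_ge {n : ℕ} (hn : 2 ≤ n) (x : Fin n → ℕ)
    (h : (n : ℤ) < 2 * residue n (total x) + 2) :
    (5 / 4 : ℝ) * n ≤ ∑ j, ((min (balls x j) (n + 1) : ℕ) : ℝ) := by
  -- A single bin that reaches the cap already suffices.
  by_cases hc : ∃ j, n + 1 ≤ balls x j
  · obtain ⟨j, hj⟩ := hc
    have h1 : ∑ k : Fin n, ((1 : ℝ) + if k = j then (n : ℝ) else 0) ≤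
        ∑ j, ((min (balls x j) (n + 1) : ℕ) : ℝ) := by
      refine Finset.sum_le_sum fun k _ => ?_
      split_ifs with hk
      · subst hk
        rw [min_eq_right hj]
        push_cast
        linarith
      · have := one_le_balls x k
        have : 1 ≤ min (balls x k) (n + 1) := by omega
        simpa using this
    simp only [Finset.sum_add_distrib, Finset.sum_const, Finset.card_univ, Fintype.card_fin,
      nsmul_eq_mul, mul_one, Finset.sum_ite_eq', Finset.mem_univ, if_true] at h1
    have : (0 : ℝ) ≤ n := by positivity
    linarith
  · push Not at hc
    -- The normalized loads sum to `0`, so this bound for every single bin gives the claim.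
    have key : ∀ j, (n : ℤ) + 4 * n ≤ 3 * (n * x j - total x) + 4 * n * (balls x j : ℤ) := by
      intro j
      by_cases hj : 0 ≤ normLoad x j
      · have h0 : (0 : ℝ) ≤ (((n : ℤ) * x j - total x : ℤ) : ℝ) := by
          rw [← natCast_mul_normLoad hn]
          positivity
        have h1 : 0 ≤ (n : ℤ) * x j - total x := by exact_mod_cast h0
        have h2 := residue_le_of_nonneg hn x j (by linarith)
        simp only [balls, hj, if_true]
        push_cast
        omega
      · have hp : 0 < ⌈-normLoad x j⌉ := Int.ceil_pos.2 (by linarith)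
        have hb : (balls x j : ℤ) = ⌈-normLoad x j⌉ + 1 := by
          simp only [balls, hj, if_false]
          omega
        have h3 : -(((n : ℤ) * x j - total x : ℤ) : ℝ) ≤ ((n * ⌈-normLoad x j⌉ : ℤ) : ℝ) := by
          rw [← natCast_mul_normLoad hn]
          push_cast
          have := Int.le_ceil (-normLoad x j)
          have hn' : (0 : ℝ) ≤ n := by positivity
          nlinarith
        have h4 : -((n : ℤ) * x j - total x : ℤ) ≤ n * ⌈-normLoad x j⌉ := by exact_mod_cast h3
        rw [hb]
        nlinarith
    have hs := Finset.sum_le_sum fun j (_ : j ∈ Finset.univ) => key j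
    have ht : ∑ j, (x j : ℤ) = total x := by simp [total]
    simp only [Finset.sum_add_distrib, ← Finset.mul_sum, Finset.sum_sub_distrib,
      Finset.sum_const, Finset.card_univ, Fintype.card_fin, nsmul_eq_mul, ht] at hs
    have hn' : (0 : ℤ) < n := by positivity
    have h5 : (5 : ℤ) * n ≤ 4 * ∑ j, (balls x j : ℤ) := by
      refine le_of_mul_le_mul_left ?_ hn'
      linarith
    have h6 : ∀ j, min (balls x j) (n + 1) = balls x j := fun j => min_eq_left (hc j).le
    simp only [h6]
    have h7 : (5 : ℝ) * n ≤ 4 * ∑ j, (balls x j : ℝ) := by exact_mod_cast h5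
    linarith

/-! ### Majorization -/

/-- If `p` is a probability vector majorized by the uniform one along `σ`, then the mean of a
function that is non-increasing along `σ` is at most its mean under the uniform distribution. -/
lemma sum_mul_le_of_majorizes {n : ℕ} (hn : 2 ≤ n) (σ : Equiv.Perm (Fin n)) (p f : Fin n → ℝ)
    (hp : ∑ k, p k = 1) (hm : Majorizes (uniformVec n) fun a => p (σ a))
    (hf : Antitone fun a => f (σ a)) : ∑ k, p k * f k ≤ (∑ k, f k) / n := by
  set q : Fin n → ℝ := fun a => p (σ a) - 1 / n with hq
  have hpre : ∀ k : ℕ, 1 ≤ k → k ≤ n → ∑ j with j.val < k, q j ≤ 0 := by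
    intro k h1 h2
    have := hm k h1 h2
    simp only [uniformVec] at this
    simp only [hq, Finset.sum_sub_distrib]
    linarith
  -- Summation by parts, as an induction over the prefixes.
  have habel : ∀ k : ℕ, ∀ hk : k < n, ∑ j with j.val < k + 1, q j * f (σ j) ≤
      f (σ ⟨k, hk⟩) * ∑ j with j.val < k + 1, q j := by
    intro k
    induction k with
    | zero =>
      intro hk
      have : (Finset.univ.filter fun j : Fin n => j.val < 0 + 1) = {⟨0, hk⟩} := by
        ext j
        simp [Fin.ext_iff]
      rw [this]
      simp [mul_comm]
    | succ k ih =>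
      intro hk
      have hins : (Finset.univ.filter fun j : Fin n => j.val < k + 1 + 1) =
          insert ⟨k + 1, hk⟩ (Finset.univ.filter fun j : Fin n => j.val < k + 1) := by
        ext j
        simp [Fin.ext_iff]
        omega
      rw [hins, Finset.sum_insert (by simp), Finset.sum_insert (by simp)]
      have h1 := ih (by omega)
      have h2 := hpre (k + 1) (by omega) (by omega)
      have h3 : f (σ ⟨k + 1, hk⟩) ≤ f (σ ⟨k, by omega⟩) :=
        hf (by simp [Fin.le_def])
      nlinarith
  have hall : (Finset.univ.filter fun j : Fin n => j.val < n - 1 + 1) = Finset.univ := by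
    ext j
    simp
    omega
  have hn' : (n : ℝ) ≠ 0 := by positivity
  have hlast := habel (n - 1) (by omega)
  rw [hall] at hlast
  have hq0 : ∑ j, q j = 0 := by
    simp only [hq, Finset.sum_sub_distrib]
    rw [Equiv.sum_comp σ p, hp]
    simp [hn']
  rw [hq0, mul_zero] at hlast
  simp only [hq, sub_mul, Finset.sum_sub_distrib] at hlast
  rw [Equiv.sum_comp σ (fun k => p k * f k), ← Finset.mul_sum, Equiv.sum_comp σ f] at hlast
  rw [div_eq_inv_mul, inv_eq_one_div]
  linarith

/-! ### The potential and its change in one round -/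

/-- The contribution of bin `j` to the exponential potential: `exp (y_j / 32)` if the bin is
overloaded, and nothing otherwise. -/
noncomputable def weight {n : ℕ} (x : Fin n → ℕ) (j : Fin n) : ℝ :=
  if 0 ≤ normLoad x j then Real.exp (normLoad x j / 32) else 0

/-- The exponential potential of the overloaded bins, corrected by the bounded factor
`exp (tent n W)`. -/
noncomputable def pot {n : ℕ} (x : Fin n → ℕ) : ℝ :=
  Real.exp (tent n (total x)) * ∑ j, weight x j

/-- The factor by which the potential changes in a round in which bin `k` is sampled because of
the growth of the total number of balls alone. -/
noncomputable def factor {n : ℕ} (x : Fin n → ℕ) (k : Fin n) : ℝ :=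
  Real.exp (-((balls x k : ℝ) / n / 32) + tent n (total x + balls x k) - tent n (total x))

/-- An upper bound for the potential after a round in which bin `k` is sampled. -/
noncomputable def stepBound {n : ℕ} (x : Fin n → ℕ) (k : Fin n) : ℝ :=
  pot x * factor x k + (Real.exp (1 / 32) - 1) * Real.exp (tent n (total x)) * weight x k + 6

lemma weight_nonneg {n : ℕ} (x : Fin n → ℕ) (j : Fin n) : 0 ≤ weight x j := by
  unfold weight
  split_ifs <;> positivity

lemma pot_nonneg {n : ℕ} (x : Fin n → ℕ) : 0 ≤ pot x :=
  mul_nonneg (Real.exp_nonneg _) (Finset.sum_nonneg fun j _ => weight_nonneg x j)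

lemma weight_le_exp {n : ℕ} (x : Fin n → ℕ) (j : Fin n) :
    weight x j ≤ Real.exp (normLoad x j / 32) := by
  unfold weight
  split_ifs
  · rfl
  · positivity

lemma weight_mono {n : ℕ} (x : Fin n → ℕ) {j k : Fin n} (h : x j ≤ x k) :
    weight x j ≤ weight x k := by
  have h' : normLoad x j ≤ normLoad x k := by
    unfold normLoad
    have : (x j : ℝ) ≤ x k := by exact_mod_cast h
    linarith
  by_cases hj : 0 ≤ normLoad x j
  · have hk : 0 ≤ normLoad x k := by linarith
    simp only [weight, hj, hk, if_true]
    gcongr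
  · simpa [weight, hj] using weight_nonneg x k

/-- In any round the tent function can undo only a small part of the decay caused by the growing
average load. -/
lemma factor_le {n : ℕ} (hn : 2 ≤ n) (x : Fin n → ℕ) (k : Fin n) :
    factor x k ≤ Real.exp (-(15 / 512 * ((balls x k : ℝ) / n))) := by
  have := tent_add_le hn (total x) (balls x k)
  have h : (balls x k : ℝ) / (512 * n) = (balls x k : ℝ) / n / 512 := by rw [mul_comm, div_div]
  unfold factor
  gcongr
  linarith

lemma factor_le_one {n : ℕ} (hn : 2 ≤ n) (x : Fin n → ℕ) (k : Fin n) : factor x k ≤ 1 := by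
  refine (factor_le hn x k).trans (Real.exp_le_one_iff.2 ?_)
  have : 0 ≤ (balls x k : ℝ) / n := by positivity
  linarith

/-- For a small residue already the first ball lowers the tent function. -/
lemma factor_le_of_residue_small {n : ℕ} (hn : 2 ≤ n) (x : Fin n → ℕ) (k : Fin n)
    (h : 2 * residue n (total x) + 2 ≤ n) :
    factor x k ≤ Real.exp (-(17 / 512 * (1 / (n : ℝ)))) := by
  obtain ⟨g, hg⟩ : ∃ g, balls x k = 1 + g := ⟨_, (Nat.add_sub_cancel' (one_le_balls x k)).symm⟩
  have h1 := tent_succ_le_of_residue_small hn h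
  have h2 := tent_add_le hn (total x + 1) g
  have h3 : (g : ℝ) / (512 * n) = (g : ℝ) / n / 512 := by rw [mul_comm, div_div]
  have h4 : (1 : ℝ) / (512 * n) = 1 / n / 512 := by rw [mul_comm, div_div]
  have h5 : 0 ≤ (g : ℝ) / n := by positivity
  unfold factor
  rw [hg, ← add_assoc]
  push_cast
  rw [add_div]
  gcongr
  linarith

lemma total_eq_of_fillingStep {n : ℕ} {x x' : Fin n → ℕ} {i : Fin n} (h : FillingStep x i x') :
    total x' = total x + balls x i := by
  obtain ⟨b, hb, hu, ho⟩ := h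
  have : total x' = total x + ∑ j, b j := by
    simp [total, hb, Finset.sum_add_distrib]
  rw [this]
  congr 1
  by_cases hi : 0 ≤ normLoad x i
  · simp [balls, hi, ho hi]
  · obtain ⟨h1, -⟩ := hu (by linarith)
    simp only [balls, hi, if_false, ← h1, Int.toNat_natCast]

lemma weight_le_of_load_eq {n : ℕ} {x x' : Fin n → ℕ} {j : Fin n} {δ : ℝ} (hδ : 0 ≤ δ)
    (havg : avg x' = avg x + δ) (hj : x' j = x j) :
    weight x' j ≤ Real.exp (-(δ / 32)) * weight x j := by
  have hy : normLoad x' j = normLoad x j - δ := by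
    unfold normLoad
    rw [hj, havg]
    ring
  by_cases h : 0 ≤ normLoad x' j
  · have h' : 0 ≤ normLoad x j := by linarith
    simp only [weight, h, h', if_true, ← Real.exp_add]
    gcongr
    linarith
  · simp only [weight, h, if_false]
    split_ifs <;> positivity

/-- One round: an overloaded bin gains a ball only if it is itself the sampled one, and in a round
with an underloaded sampled bin at most two bins become overloaded, with normalized load at
most `2`. -/
lemma pot_le_stepBound {n : ℕ} (hn : 2 ≤ n) {x x' : Fin n → ℕ} {i : Fin n}
    (h : FillingStep x i x') : pot x' ≤ stepBound x i := by
  have htot := total_eq_of_fillingStep h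
  set δ : ℝ := (balls x i : ℝ) / n with hδ
  have hδ0 : 0 ≤ δ := by positivity
  have havg : avg x' = avg x + δ := by
    unfold avg
    rw [htot, hδ]
    push_cast
    ring
  have hfac : Real.exp (tent n (total x')) * Real.exp (-(δ / 32)) =
      Real.exp (tent n (total x)) * factor x i := by
    rw [factor, ← Real.exp_add, ← Real.exp_add, htot]
    congr 1
    ring
  have he1 : (1 : ℝ) ≤ Real.exp (1 / 32) := Real.one_le_exp (by norm_num)
  obtain ⟨b, hb, hu, ho⟩ := h
  by_cases hi : 0 ≤ normLoad x i
  · have hbi := ho hi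
    have hw : ∀ j, weight x' j ≤ Real.exp (-(δ / 32)) *
        (weight x j + if j = i then (Real.exp (1 / 32) - 1) * weight x i else 0) := by
      intro j
      by_cases hj : j = i
      · subst hj
        have hy : normLoad x' j = normLoad x j + 1 - δ := by
          unfold normLoad
          rw [hb, havg, hbi]
          simp
          ring
        refine (weight_le_exp x' j).trans (le_of_eq ?_)
        rw [if_pos rfl]
        have : weight x j = Real.exp (normLoad x j / 32) := by simp [weight, hi]
        rw [show ∀ w : ℝ, w + (Real.exp (1 / 32) - 1) * w = Real.exp (1 / 32) * w by
          intro w; ring, this, ← Real.exp_add, ← Real.exp_add, hy]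
        congr 1
        ring
      · have : x' j = x j := by rw [hb, hbi]; simp [hj]
        simpa [hj] using weight_le_of_load_eq hδ0 havg this
    have hsum := Finset.sum_le_sum fun j (_ : j ∈ Finset.univ) => hw j
    rw [← Finset.mul_sum, Finset.sum_add_distrib, Finset.sum_ite_eq' Finset.univ i,
      if_pos (Finset.mem_univ _)] at hsum
    have h1 : pot x' ≤ pot x * factor x i +
        ((Real.exp (1 / 32) - 1) * Real.exp (tent n (total x)) * weight x i) * factor x i := by
      unfold pot
      calc _ ≤ Real.exp (tent n (total x')) * (Real.exp (-(δ / 32)) *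
            (∑ j, weight x j + (Real.exp (1 / 32) - 1) * weight x i)) := by gcongr
        _ = Real.exp (tent n (total x')) * Real.exp (-(δ / 32)) *
            (∑ j, weight x j + (Real.exp (1 / 32) - 1) * weight x i) := by ring
        _ = _ := by rw [hfac]; ring
    have h2 : 0 ≤ (Real.exp (1 / 32) - 1) * Real.exp (tent n (total x)) * weight x i :=
      mul_nonneg (mul_nonneg (by linarith) (Real.exp_nonneg _)) (weight_nonneg x i)
    have h3 := mul_le_of_le_one_right h2 (factor_le_one hn x i)
    unfold stepBound
    linarith
  · obtain ⟨-, k₁, k₂, hk1, hk2, hk⟩ := hu (by linarith)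
    -- A bin that gets at most `⌈-y_j⌉ + 1 < -y_j + 2` balls ends below normalized load `2`.
    have hnew : ∀ j, ((b j : ℤ) ≤ ⌈-normLoad x j⌉ + 1 ∨ b j = 0) →
        weight x' j ≤ Real.exp (-(δ / 32)) * weight x j + Real.exp (1 / 16) := by
      intro j hj
      by_cases h0 : b j = 0
      · have : x' j = x j := by rw [hb, h0, add_zero]
        have := weight_le_of_load_eq hδ0 havg this
        have : 0 ≤ Real.exp (1 / 16) := Real.exp_nonneg _
        linarith
      · have h1 : (b j : ℤ) ≤ ⌈-normLoad x j⌉ + 1 := by tauto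
        have h2 : (b j : ℝ) ≤ ⌈-normLoad x j⌉ + 1 := by exact_mod_cast h1
        have h3 := Int.ceil_lt_add_one (-normLoad x j)
        have hy : normLoad x' j = normLoad x j + b j - δ := by
          unfold normLoad
          rw [hb, havg]
          push_cast
          ring
        have h4 : weight x' j ≤ Real.exp (1 / 16) :=
          (weight_le_exp x' j).trans (Real.exp_le_exp.2 (by linarith))
        have : 0 ≤ Real.exp (-(δ / 32)) * weight x j :=
          mul_nonneg (Real.exp_nonneg _) (weight_nonneg x j)
        linarith
    have hw : ∀ j, weight x' j ≤ Real.exp (-(δ / 32)) * weight x j +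
        ((if j = k₁ then Real.exp (1 / 16) else 0) +
          if j = k₂ then Real.exp (1 / 16) else 0) := by
      intro j
      have hexp : 0 ≤ Real.exp (1 / 16) := Real.exp_nonneg _
      by_cases h1 : j = k₁
      · have := hnew j (by subst h1; omega)
        rw [if_pos h1]
        split_ifs <;> linarith
      · by_cases h2 : j = k₂
        · have := hnew j (by subst h2; have := hk2 h1; omega)
          rw [if_neg h1, if_pos h2]
          linarith
        · have hbj := hk j h1 h2
          rw [if_neg h1, if_neg h2, add_zero, add_zero]
          -- A bin other than `k₁`, `k₂` that gets a ball stays underloaded.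
          by_cases h0 : b j = 0
          · have : x' j = x j := by rw [hb, h0, add_zero]
            exact weight_le_of_load_eq hδ0 havg this
          · have h4 : (b j : ℤ) ≤ ⌈-normLoad x j⌉ - 1 := by omega
            have h5 : (b j : ℝ) ≤ ⌈-normLoad x j⌉ - 1 := by exact_mod_cast h4
            have h6 := Int.ceil_lt_add_one (-normLoad x j)
            have hy : ¬ 0 ≤ normLoad x' j := by
              unfold normLoad at h5 h6 ⊢
              rw [hb, havg]
              push_cast
              linarith
            have : weight x' j = 0 := by simp [weight, hy]
            rw [this]
            exact mul_nonneg (Real.exp_nonneg _) (weight_nonneg x j)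
    have hsum := Finset.sum_le_sum fun j (_ : j ∈ Finset.univ) => hw j
    rw [Finset.sum_add_distrib, Finset.sum_add_distrib, ← Finset.mul_sum,
      Finset.sum_ite_eq' Finset.univ k₁, Finset.sum_ite_eq' Finset.univ k₂,
      if_pos (Finset.mem_univ _), if_pos (Finset.mem_univ _)] at hsum
    have hconst : Real.exp (tent n (total x')) * Real.exp (1 / 16) ≤ 3 := by
      rw [← Real.exp_add]
      have := tent_le hn (total x')
      calc _ ≤ Real.exp 1 := by gcongr; linarith
        _ ≤ 3 := by linarith [Real.exp_one_lt_d9]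
    have h1 : pot x' ≤ pot x * factor x i + 6 := by
      unfold pot
      calc _ ≤ Real.exp (tent n (total x')) * (Real.exp (-(δ / 32)) * ∑ j, weight x j +
            (Real.exp (1 / 16) + Real.exp (1 / 16))) := by gcongr
        _ = Real.exp (tent n (total x')) * Real.exp (-(δ / 32)) * ∑ j, weight x j +
            2 * (Real.exp (tent n (total x')) * Real.exp (1 / 16)) := by ring
        _ ≤ Real.exp (tent n (total x')) * Real.exp (-(δ / 32)) * ∑ j, weight x j + 2 * 3 := by
            gcongr
        _ = _ := by rw [hfac]; ring
    have h2 : 0 ≤ (Real.exp (1 / 32) - 1) * Real.exp (tent n (total x)) * weight x i :=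
      mul_nonneg (mul_nonneg (by linarith) (Real.exp_nonneg _)) (weight_nonneg x i)
    unfold stepBound
    linarith

/-! ### The drift inequality -/

lemma exp_neg_le {z : ℝ} (h0 : 0 ≤ z) (h1 : z ≤ 1) : Real.exp (-z) ≤ 1 - z + z ^ 2 := by
  have := (abs_le.1 (Real.abs_exp_sub_one_sub_id_le (x := -z)
    (by rwa [abs_neg, abs_of_nonneg h0]))).2
  nlinarith

/-- The mean of `factor` beats the growth `exp (1 / 32) - 1 ≤ 33 / 1024` of the sampled bin, with
`1 / 4096` to spare. For a small residue the tent function provides the necessary decay, otherwise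
the mean number of balls, at least `5 / 4`, does. -/
lemma sum_mul_factor_le {n : ℕ} (hn : 2 ≤ n) (x : Fin n → ℕ) (σ : Equiv.Perm (Fin n))
    (hσ : IsSortedLabeling x σ) (p : Fin n → ℝ) (hp0 : ∀ k, 0 ≤ p k) (hp : ∑ k, p k = 1)
    (hm : Majorizes (uniformVec n) fun a => p (σ a)) :
    ∑ k, p k * factor x k ≤ 1 - (33 / 1024 + 1 / 4096) / n := by
  have hn2 : (2 : ℝ) ≤ n := by exact_mod_cast hn
  set v : ℝ := 1 / n with hv
  have hv0 : 0 < v := by positivity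
  have hv1 : v ≤ 1 / 2 := by
    rw [hv]
    gcongr
  have hdiv : ∀ a : ℝ, a / n = a * v := fun a => by rw [hv]; ring
  by_cases h : 2 * residue n (total x) + 2 ≤ n
  · calc ∑ k, p k * factor x k ≤ ∑ k, p k * Real.exp (-(17 / 512 * v)) :=
          Finset.sum_le_sum fun k _ =>
            mul_le_mul_of_nonneg_left (factor_le_of_residue_small hn x k h) (hp0 k)
      _ = Real.exp (-(17 / 512 * v)) := by rw [← Finset.sum_mul, hp, one_mul]
      _ ≤ 1 - 17 / 512 * v + (17 / 512 * v) ^ 2 := exp_neg_le (by positivity) (by linarith)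
      _ ≤ _ := by
        rw [hdiv]
        nlinarith
  · push Not at h
    set g : Fin n → ℝ := fun k => ((min (balls x k) (n + 1) : ℕ) : ℝ) with hg
    have hg0 : ∀ k, 0 ≤ g k := fun k => Nat.cast_nonneg _
    -- The cap `n + 1` keeps the exponent bounded, so that `exp_neg_le` is nearly linear.
    have hgv : ∀ k, g k * v ≤ 3 / 2 := by
      intro k
      have h1 : g k ≤ n + 1 := by
        have : min (balls x k) (n + 1) ≤ n + 1 := min_le_right _ _
        simp only [hg]
        exact_mod_cast this
      have : (n : ℝ) * v = 1 := by rw [hv]; field_simp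
      nlinarith
    have hf : ∀ k, factor x k ≤ 1 - 7 / 256 * (g k * v) := by
      intro k
      have h1 : g k ≤ balls x k := by
        have : min (balls x k) (n + 1) ≤ balls x k := min_le_left _ _
        simp only [hg]
        exact_mod_cast this
      have h0 : 0 ≤ g k * v := mul_nonneg (hg0 k) hv0.le
      calc factor x k ≤ Real.exp (-(15 / 512 * ((balls x k : ℝ) / n))) := factor_le hn x k
        _ ≤ Real.exp (-(15 / 512 * (g k * v))) := by
          rw [hdiv]
          gcongr
        _ ≤ 1 - 15 / 512 * (g k * v) + (15 / 512 * (g k * v)) ^ 2 :=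
          exp_neg_le (by positivity) (by linarith [hgv k])
        _ ≤ _ := by nlinarith [hgv k]
    have hmean : 5 / 4 ≤ ∑ k, p k * g k := by
      have h1 := sum_mul_le_of_majorizes hn σ p (fun k => - g k) hp hm (by
        intro a c hac
        have : balls x (σ a) ≤ balls x (σ c) := balls_anti x (hσ hac)
        have : min (balls x (σ a)) (n + 1) ≤ min (balls x (σ c)) (n + 1) := by omega
        simp only [hg, neg_le_neg_iff]
        exact_mod_cast this)
      have h2 := sum_min_balls_ge hn x h
      have h3 : 5 / 4 ≤ (∑ k, g k) / n := by
        rw [le_div_iff₀ (by positivity)]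
        exact h2
      simp only [mul_neg, Finset.sum_neg_distrib, neg_div] at h1
      linarith
    calc ∑ k, p k * factor x k ≤ ∑ k, p k * (1 - 7 / 256 * (g k * v)) :=
          Finset.sum_le_sum fun k _ => mul_le_mul_of_nonneg_left (hf k) (hp0 k)
      _ = 1 - 7 / 256 * v * ∑ k, p k * g k := by
        simp only [mul_sub, mul_one, Finset.sum_sub_distrib, hp, Finset.mul_sum]
        congr 1
        exact Finset.sum_congr rfl fun k _ => by ring
      _ ≤ _ := by
        rw [hdiv]
        nlinarith

/-- The drift inequality: the expectation of `stepBound` over the sampled bin contracts the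
potential up to an additive constant. -/
lemma sum_mul_stepBound_le {n : ℕ} (hn : 2 ≤ n) (x : Fin n → ℕ) (σ : Equiv.Perm (Fin n))
    (hσ : IsSortedLabeling x σ) (p : Fin n → ℝ) (hp0 : ∀ k, 0 ≤ p k) (hp : ∑ k, p k = 1)
    (hm : Majorizes (uniformVec n) fun a => p (σ a)) :
    ∑ k, p k * stepBound x k ≤ (1 - 1 / 4096 / n) * pot x + 6 := by
  have h1 := sum_mul_factor_le hn x σ hσ p hp0 hp hm
  have h2 := sum_mul_le_of_majorizes hn σ p (weight x) hp hm
    fun a c hac => weight_mono x (hσ hac)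
  have he : Real.exp (1 / 32) - 1 ≤ 33 / 1024 := by
    have := (abs_le.1 (Real.abs_exp_sub_one_sub_id_le (x := 1 / 32)
      (by rw [abs_of_nonneg] <;> norm_num))).2
    linarith
  have he0 : 0 ≤ Real.exp (1 / 32) - 1 := by
    have := Real.one_le_exp (x := 1 / 32) (by norm_num)
    linarith
  have hE : 0 ≤ (Real.exp (1 / 32) - 1) * Real.exp (tent n (total x)) := by positivity
  have hpot := pot_nonneg x
  calc ∑ k, p k * stepBound x k
      = pot x * ∑ k, p k * factor x k +
        (Real.exp (1 / 32) - 1) * Real.exp (tent n (total x)) * ∑ k, p k * weight x k +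
        6 * ∑ k, p k := by
        simp only [Finset.mul_sum, ← Finset.sum_add_distrib]
        refine Finset.sum_congr rfl fun k _ => ?_
        unfold stepBound
        ring
    _ ≤ pot x * (1 - (33 / 1024 + 1 / 4096) / n) +
        (Real.exp (1 / 32) - 1) * Real.exp (tent n (total x)) * ((∑ k, weight x k) / n) +
        6 * 1 := by
        rw [hp]
        gcongr
    _ = pot x * (1 - (33 / 1024 + 1 / 4096) / n) + (Real.exp (1 / 32) - 1) * (pot x / n) + 6 := by
        unfold pot
        ring
    _ ≤ pot x * (1 - (33 / 1024 + 1 / 4096) / n) + 33 / 1024 * (pot x / n) + 6 := by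
        gcongr
    _ = _ := by ring

lemma stepBound_nonneg {n : ℕ} (x : Fin n → ℕ) (k : Fin n) : 0 ≤ stepBound x k := by
  have h1 := Real.one_le_exp (x := 1 / 32) (by norm_num)
  have h2 : 0 ≤ pot x * factor x k := mul_nonneg (pot_nonneg x) (Real.exp_nonneg _)
  have h3 : 0 ≤ (Real.exp (1 / 32) - 1) * Real.exp (tent n (total x)) * weight x k :=
    mul_nonneg (mul_nonneg (by linarith) (Real.exp_nonneg _)) (weight_nonneg x k)
  unfold stepBound
  linarith

lemma stepBound_le {n : ℕ} (hn : 2 ≤ n) (x : Fin n → ℕ) (k : Fin n) :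
    stepBound x k ≤ Real.exp (1 / 32) * pot x + 6 := by
  have h1 := Real.one_le_exp (x := 1 / 32) (by norm_num)
  have h2 := mul_le_of_le_one_right (pot_nonneg x) (factor_le_one hn x k)
  have h3 : Real.exp (tent n (total x)) * weight x k ≤ pot x := by
    unfold pot
    gcongr
    exact Finset.single_le_sum (fun j _ => weight_nonneg x j) (Finset.mem_univ k)
  unfold stepBound
  nlinarith

open MeasureTheory

/-! ### The expected potential of a filling process -/

section FillingProcess

variable {n : ℕ} {Ω : Type*} [mΩ : MeasurableSpace Ω] {μ : Measure Ω}
  {ℱ : Filtration ℕ mΩ} {x : ℕ → Ω → Fin n → ℕ} {i : ℕ → Ω → Fin n}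

lemma selProb_nonneg (t : ℕ) : ∀ᵐ ω ∂μ, ∀ k, 0 ≤ selProb μ ℱ i t k ω := by
  rw [ae_all_iff]
  intro k
  exact condExp_nonneg (Filter.Eventually.of_forall fun ω =>
    Set.indicator_nonneg (fun _ _ => zero_le_one) ω)

lemma conditionP1_of_uniformSampling (hU : UniformSampling μ ℱ i) : ConditionP1 μ ℱ x i := by
  intro t
  filter_upwards [ae_all_iff.2 (hU t)] with ω hω
  have hsort := Tuple.monotone_sort fun j => OrderDual.toDual (x t ω j)
  refine ⟨Tuple.sort fun j => OrderDual.toDual (x t ω j), fun a c hac => hsort hac, ?_⟩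
  intro k _ _
  simp [hω, uniformVec]

variable [IsProbabilityMeasure μ]

lemma sum_selProb (hi : ∀ t, Measurable (i t)) (t : ℕ) :
    ∀ᵐ ω ∂μ, ∑ k, selProb μ ℱ i t k ω = 1 := by
  have h1 := condExp_finsetSum (μ := μ) (m := ℱ t) (s := (Finset.univ : Finset (Fin n)))
    (f := fun k => {ω | i t ω = k}.indicator fun _ => (1 : ℝ))
    (fun k _ => (integrable_const 1).indicator (hi t (measurableSet_singleton k)))
  have h2 : (∑ k : Fin n, {ω | i t ω = k}.indicator fun _ => (1 : ℝ)) = fun _ => 1 := by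
    ext ω
    simp [Finset.sum_apply, Set.indicator_apply]
  rw [h2, condExp_const (ℱ.le t)] at h1
  filter_upwards [h1] with ω hω
  rw [Finset.sum_apply] at hω
  exact hω.symm

/-- Integrating a function of the current loads and the sampled bin amounts to averaging it over
the conditional distribution of that bin. -/
lemma integral_comp_bin (hx : ∀ t, Measurable[ℱ t] (x t)) (hi : ∀ t, Measurable (i t)) (t : ℕ)
    (f : (Fin n → ℕ) → Fin n → ℝ) (hf : ∀ k, Integrable (fun ω => f (x t ω) k) μ) :
    Integrable (fun ω => f (x t ω) (i t ω)) μ ∧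
      Integrable (fun ω => ∑ k, selProb μ ℱ i t k ω * f (x t ω) k) μ ∧
      ∫ ω, f (x t ω) (i t ω) ∂μ = ∫ ω, ∑ k, selProb μ ℱ i t k ω * f (x t ω) k ∂μ := by
  have hset : ∀ k, MeasurableSet {ω | i t ω = k} := fun k => hi t (measurableSet_singleton k)
  set F : Fin n → Ω → ℝ := fun k ω => f (x t ω) k with hF
  set I : Fin n → Ω → ℝ := fun k => {ω | i t ω = k}.indicator fun _ => (1 : ℝ) with hI
  have hprod : ∀ k, F k * I k = {ω | i t ω = k}.indicator (F k) := by
    intro k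
    ext ω
    simp [hI, Set.indicator_apply]
  have hint : ∀ k, Integrable (F k * I k) μ := fun k => by
    rw [hprod]
    exact (hf k).indicator (hset k)
  have hsplit : (fun ω => f (x t ω) (i t ω)) = fun ω => ∑ k, (F k * I k) ω := by
    ext ω
    simp [hI, hF, Set.indicator_apply]
  have hpull : ∀ k, μ[F k * I k | ℱ t] =ᵐ[μ] F k * selProb μ ℱ i t k := fun k =>
    condExp_mul_of_stronglyMeasurable_left
      (((Measurable.of_discrete (f := fun z => f z k)).comp (hx t)).stronglyMeasurable)
      (hint k) ((integrable_const 1).indicator (hset k))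
  have hint' : ∀ k, Integrable (fun ω => selProb μ ℱ i t k ω * f (x t ω) k) μ := fun k =>
    integrable_condExp.congr ((hpull k).trans (Filter.Eventually.of_forall fun ω => by
      simp [hF, mul_comm]))
  refine ⟨?_, integrable_finsetSum _ fun k _ => hint' k, ?_⟩
  · rw [hsplit]
    exact integrable_finsetSum _ fun k _ => hint k
  · rw [hsplit, integral_finsetSum _ fun k _ => hint k, integral_finsetSum _ fun k _ => hint' k]
    refine Finset.sum_congr rfl fun k _ => ?_
    rw [← integral_condExp (ℱ.le t)]
    refine integral_congr_ae ((hpull k).trans (Filter.Eventually.of_forall fun ω => ?_))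
    simp [hF, mul_comm]

lemma pot_zero (n : ℕ) (hn : 2 ≤ n) : pot (0 : Fin n → ℕ) ≤ 2 * n := by
  have h1 : total (0 : Fin n → ℕ) = 0 := by simp [total]
  have h2 : ∀ j, weight (0 : Fin n → ℕ) j = 1 := by
    intro j
    simp [weight, normLoad, avg, h1]
  have h3 := tent_le hn 0
  have h4 : Real.exp (tent n 0) ≤ 2 := by
    have := (abs_le.1 (Real.abs_exp_sub_one_sub_id_le (x := tent n 0)
      (by rw [abs_of_nonneg (tent_nonneg hn 0)]; linarith))).2
    nlinarith [tent_nonneg hn 0]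
  unfold pot
  simp only [h1, h2, Finset.sum_const, Finset.card_univ, Fintype.card_fin, nsmul_eq_mul, mul_one]
  gcongr

/-- The potential of a filling process stays linear in `n` on average, at all times. -/
lemma integral_pot_le (hn : 2 ≤ n) (hA : IsAllocationProcess μ ℱ x i)
    (hP : ConditionP1 μ ℱ x i) (hW : ConditionW1 μ x i) (t : ℕ) :
    Integrable (fun ω => pot (x t ω)) μ ∧ ∫ ω, pot (x t ω) ∂μ ≤ 24576 * n := by
  have hx : ∀ t, Measurable (x t) := fun t => (hA.measurable_load t).mono (ℱ.le t) le_rfl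
  have hmeas : ∀ t, Measurable fun ω => pot (x t ω) := fun t =>
    (Measurable.of_discrete (f := pot)).comp (hx t)
  have hn0 : (0 : ℝ) < n := by positivity
  induction t with
  | zero =>
    have h0 : (fun ω => pot (x 0 ω)) =ᵐ[μ] fun _ => pot (0 : Fin n → ℕ) := by
      filter_upwards [hA.load_zero] with ω hω
      rw [hω]
    refine ⟨(integrable_congr h0).2 (integrable_const _), ?_⟩
    rw [integral_congr_ae h0]
    have := pot_zero n hn
    simp only [integral_const, probReal_univ, one_smul]
    linarith
  | succ t ih =>
    obtain ⟨ih1, ih2⟩ := ih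
    have hsb : ∀ k, Integrable (fun ω => stepBound (x t ω) k) μ := fun k => by
      refine ((ih1.const_mul (Real.exp (1 / 32))).add (integrable_const 6)).mono'
        ((Measurable.of_discrete (f := fun z => stepBound z k)).comp (hx t)).aestronglyMeasurable
        (Filter.Eventually.of_forall fun ω => ?_)
      rw [Real.norm_of_nonneg (stepBound_nonneg _ _)]
      exact stepBound_le hn _ _
    obtain ⟨h1, h2, h3⟩ := integral_comp_bin hA.measurable_load hA.measurable_bin t stepBound hsb
    have hstep : ∀ᵐ ω ∂μ, pot (x (t + 1) ω) ≤ stepBound (x t ω) (i t ω) := by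
      filter_upwards [hW t] with ω hω
      exact pot_le_stepBound hn hω
    have hint : Integrable (fun ω => pot (x (t + 1) ω)) μ := by
      refine h1.mono' (hmeas _).aestronglyMeasurable ?_
      filter_upwards [hstep] with ω hω
      rwa [Real.norm_of_nonneg (pot_nonneg _)]
    refine ⟨hint, ?_⟩
    have hdrift : ∀ᵐ ω ∂μ, ∑ k, selProb μ ℱ i t k ω * stepBound (x t ω) k ≤
        (1 - 1 / 4096 / n) * pot (x t ω) + 6 := by
      filter_upwards [hP t, selProb_nonneg (μ := μ) (ℱ := ℱ) (i := i) t,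
        sum_selProb (μ := μ) (ℱ := ℱ) hA.measurable_bin t] with ω ⟨σ, hσ, hm⟩ h0 hs
      exact sum_mul_stepBound_le hn (x t ω) σ hσ (fun k => selProb μ ℱ i t k ω) h0 hs hm
    calc ∫ ω, pot (x (t + 1) ω) ∂μ ≤ ∫ ω, stepBound (x t ω) (i t ω) ∂μ :=
          integral_mono_ae hint h1 hstep
      _ = ∫ ω, ∑ k, selProb μ ℱ i t k ω * stepBound (x t ω) k ∂μ := h3
      _ ≤ ∫ ω, ((1 - 1 / 4096 / n) * pot (x t ω) + 6) ∂μ :=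
          integral_mono_ae h2 ((ih1.const_mul _).add (integrable_const 6)) hdrift
      _ = (1 - 1 / 4096 / n) * ∫ ω, pot (x t ω) ∂μ + 6 := by
          rw [integral_add (ih1.const_mul _) (integrable_const 6), integral_const_mul]
          simp
      _ ≤ (1 - 1 / 4096 / n) * (24576 * n) + 6 := by
          have hn2 : (1 : ℝ) ≤ n := by exact_mod_cast (by omega : 1 ≤ n)
          have : 0 ≤ 1 - 1 / 4096 / (n : ℝ) := by
            rw [sub_nonneg, div_le_one hn0]
            linarith
          gcongr
      -- `24576 = 6 * 4096` is the fixed point of the recursion.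
      _ = 24576 * n := by
          field_simp
          ring

/-- A bin of maximum load is overloaded, so the potential controls the gap. -/
lemma exp_gap_le_pot (hn : 2 ≤ n) (z : Fin n → ℕ) : Real.exp (gap z / 32) ≤ pot z := by
  have : Nonempty (Fin n) := ⟨⟨0, by omega⟩⟩
  have hn0 : (0 : ℝ) < n := by positivity
  obtain ⟨j, hj⟩ := exists_eq_ciSup_of_finite (f := fun j => (z j : ℝ))
  have hle : ∀ k, (z k : ℝ) ≤ z j := fun k => by
    rw [hj]
    exact le_ciSup (f := fun j => (z j : ℝ)) (Set.finite_range _).bddAbove k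
  have hgap : gap z = normLoad z j := by
    unfold gap normLoad
    rw [hj]
  have hpos : 0 ≤ normLoad z j := by
    have h1 : (total z : ℝ) ≤ z j * n := by
      have := Finset.sum_le_sum fun k (_ : k ∈ Finset.univ) => hle k
      simp only [Finset.sum_const, Finset.card_univ, Fintype.card_fin, nsmul_eq_mul] at this
      unfold total
      push_cast
      linarith
    unfold normLoad avg
    rw [sub_nonneg, div_le_iff₀ hn0]
    exact h1
  have hw : weight z j = Real.exp (gap z / 32) := by
    rw [hgap]
    simp [weight, hpos]
  have h1 : weight z j ≤ ∑ k, weight z k :=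
    Finset.single_le_sum (fun k _ => weight_nonneg z k) (Finset.mem_univ j)
  have h2 := Real.one_le_exp (tent_nonneg hn (total z))
  have h3 := weight_nonneg z j
  unfold pot
  rw [← hw]
  nlinarith

/-- Markov's inequality for the potential. -/
lemma measureReal_gap_gt_le (hn : 2 ≤ n) (hA : IsAllocationProcess μ ℱ x i)
    (hP : ConditionP1 μ ℱ x i) (hW : ConditionW1 μ x i) (t : ℕ) (c : ℝ) :
    μ.real {ω | c < gap (x t ω)} ≤ 24576 * n * Real.exp (-(c / 32)) := by
  obtain ⟨h1, h2⟩ := integral_pot_le hn hA hP hW t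
  have h3 := mul_meas_ge_le_integral_of_nonneg
    (Filter.Eventually.of_forall fun ω => pot_nonneg (x t ω)) h1 (Real.exp (c / 32))
  have h4 : μ.real {ω | c < gap (x t ω)} ≤ μ.real {ω | Real.exp (c / 32) ≤ pot (x t ω)} := by
    refine measureReal_mono fun ω hω => ?_
    refine le_trans ?_ (exp_gap_le_pot hn (x t ω))
    have : c < gap (x t ω) := hω
    gcongr
  have h5 := Real.exp_pos (c / 32)
  rw [Real.exp_neg, ← div_eq_mul_inv, le_div_iff₀ h5, mul_comm]
  calc _ ≤ Real.exp (c / 32) * μ.real {ω | Real.exp (c / 32) ≤ pot (x t ω)} := by gcongr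
    _ ≤ _ := h3.trans h2

/-- The gap bound, with `C = 576`: since `24576 ≤ 2 ^ 15 ≤ n ^ 15`, the constant `32 * 18` leaves
the failure probability `n ^ 15 * n * n ^ (-18)`. -/
lemma measureReal_gap_le (hA : IsAllocationProcess μ ℱ x i)
    (hP : ConditionP1 μ ℱ x i) (hW : ConditionW1 μ x i) (t : ℕ) :
    1 - ((n : ℝ) ^ 2)⁻¹ ≤ μ.real {ω | gap (x t ω) ≤ 576 * Real.log n} := by
  obtain rfl | rfl | hn : n = 0 ∨ n = 1 ∨ 2 ≤ n := by omega
  · have ⟨ω⟩ : Nonempty Ω := nonempty_of_isProbabilityMeasure μ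
    exact (i 0 ω).elim0
  · simp
  · have hx : Measurable (x t) := (hA.measurable_load t).mono (ℱ.le t) le_rfl
    have hms : MeasurableSet {ω | gap (x t ω) ≤ 576 * Real.log n} :=
      measurableSet_le ((Measurable.of_discrete (f := gap)).comp hx) measurable_const
    have h1 := measureReal_gap_gt_le hn hA hP hW t (576 * Real.log n)
    have hn0 : (0 : ℝ) < n := by positivity
    have h2 : Real.exp (-(576 * Real.log n / 32)) = ((n : ℝ) ^ 18)⁻¹ := by
      rw [Real.exp_neg, show 576 * Real.log n / 32 = (18 : ℕ) * Real.log n by push_cast; ring,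
        Real.exp_nat_mul, Real.exp_log hn0]
    have h3 : 24576 * (n : ℝ) * ((n : ℝ) ^ 18)⁻¹ ≤ ((n : ℝ) ^ 2)⁻¹ := by
      have hn2 : (2 : ℝ) ≤ n := by exact_mod_cast hn
      have h4 : (2 : ℝ) ^ 15 ≤ (n : ℝ) ^ 15 := by gcongr
      rw [← div_eq_mul_inv, ← one_div, div_le_div_iff₀ (by positivity) (by positivity)]
      calc 24576 * (n : ℝ) * (n : ℝ) ^ 2 ≤ (n : ℝ) ^ 15 * n * (n : ℝ) ^ 2 := by
            gcongr
            linarith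
        _ = 1 * (n : ℝ) ^ 18 := by ring
    have h5 : {ω | 576 * Real.log n < gap (x t ω)} = {ω | gap (x t ω) ≤ 576 * Real.log n}ᶜ := by
      ext ω
      simp
    rw [h5, probReal_compl_eq_one_sub hms, h2] at h1
    linarith

end FillingProcess

/-! ### Packing and OverPacking -/

lemma ceil_neg_normLoad {n : ℕ} (x : Fin n → ℕ) (j : Fin n) :
    ⌈-normLoad x j⌉ = ⌈avg x⌉ - x j := by
  rw [normLoad, neg_sub, Int.ceil_sub_natCast]

/-- All balls go to the sampled bin, so both exceptional bins may be taken to be that one. -/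
lemma fillingStep_of_packingStep {n : ℕ} {x x' : Fin n → ℕ} {i : Fin n}
    (h : PackingStep x i x') : FillingStep x i x' := by
  obtain ⟨hne, hu, ho⟩ := h
  have hle : x i ≤ x' i := by
    by_cases hi : 0 ≤ normLoad x i
    · have := ho hi
      omega
    · have h1 := hu (by linarith)
      have h2 : 0 < ⌈-normLoad x i⌉ := Int.ceil_pos.2 (by linarith)
      rw [ceil_neg_normLoad] at h2
      omega
  refine ⟨Pi.single i (x' i - x i), fun j => ?_, fun hi => ?_, fun hi => ?_⟩
  · by_cases hj : j = i
    · subst hj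
      simp
      omega
    · simp [hj, hne j hj]
  · have h1 := hu hi
    have h2 := ceil_neg_normLoad x i
    refine ⟨?_, i, i, ?_, fun hh => (hh rfl).elim, fun j hj _ => ?_⟩
    · rw [Finset.sum_pi_single']
      simp
      omega
    · simp
      omega
    · simp [hj]
  · have := ho hi
    congr 1
    omega

/-- Both exceptional bins may be taken to be the first underloaded one. -/
lemma fillingStep_of_overPackingStep {n : ℕ} {x x' : Fin n → ℕ} {i : Fin n}
    (h : OverPackingStep x i x') : FillingStep x i x' := by
  obtain ⟨b, hb, hu, ho⟩ := h
  refine ⟨b, hb, fun hi => ?_, ho⟩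
  obtain ⟨hsum, σ, j, -, -, -, hk, -, hj⟩ := hu hi
  refine ⟨hsum, j, j, ?_, fun hh => (hh rfl).elim, fun k hkj _ => hk k hkj⟩
  rcases hj with hj | ⟨hj, -⟩ <;> omega

end BallsBins

theorem theorem4p3 :
    -- the gap bound, with one constant for all filling processes and all numbers of bins
    (∃ C : ℝ, 0 < C ∧
      ∀ (n : ℕ) (Ω : Type*) [mΩ : MeasurableSpace Ω] (μ : MeasureTheory.Measure Ω)
        [MeasureTheory.IsProbabilityMeasure μ] (ℱ : MeasureTheory.Filtration ℕ mΩ)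
        (x : ℕ → Ω → Fin n → ℕ) (i : ℕ → Ω → Fin n),
        BallsBins.IsAllocationProcess μ ℱ x i →
        BallsBins.ConditionP1 μ ℱ x i →
        BallsBins.ConditionW1 μ x i →
        ∀ m : ℕ, 1 ≤ m →
          1 - ((n : ℝ) ^ 2)⁻¹ ≤ μ.real {ω | BallsBins.gap (x m ω) ≤ C * Real.log n}) ∧
    -- Packing and OverPacking are filling processes
    (∀ (n : ℕ) (Ω : Type*) [mΩ : MeasurableSpace Ω] (μ : MeasureTheory.Measure Ω)
        [MeasureTheory.IsProbabilityMeasure μ] (ℱ : MeasureTheory.Filtration ℕ mΩ)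
        (x : ℕ → Ω → Fin n → ℕ) (i : ℕ → Ω → Fin n),
        BallsBins.IsAllocationProcess μ ℱ x i →
        BallsBins.UniformSampling μ ℱ i →
        ((∀ t, ∀ᵐ ω ∂μ, BallsBins.PackingStep (x t ω) (i t ω) (x (t + 1) ω)) ∨
          (∀ t, ∀ᵐ ω ∂μ, BallsBins.OverPackingStep (x t ω) (i t ω) (x (t + 1) ω))) →
        BallsBins.ConditionP1 μ ℱ x i ∧ BallsBins.ConditionW1 μ x i) := by
  refine ⟨⟨576, by norm_num, ?_⟩, ?_⟩
  · intro n Ω mΩ μ _ ℱ x i hA hP hW m _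
    exact BallsBins.measureReal_gap_le hA hP hW m
  · intro n Ω mΩ μ _ ℱ x i _ hU hstep
    refine ⟨BallsBins.conditionP1_of_uniformSampling hU, fun t => ?_⟩
    rcases hstep with hstep | hstep
    · filter_upwards [hstep t] with ω hω
      exact BallsBins.fillingStep_of_packingStep hω
    · filter_upwards [hstep t] with ω hω
      exact BallsBins.fillingStep_of_overPackingStep hω
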